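/- Let $p$ be a prime. For a finite $p$-group $G$ of nilpotence class $c$, with upper central series $1 = Z_0(G) \le Z_1(G) \le \dots \le Z_c(G) = G$, call $Z_i(G)\setminus Z_{i-1}(G)$, for $1 \le i \le c$, the $i$-th layer of $G$, and call the set of those $1 \le i \le c$ for which the $i$-th layer contains an element of order $p$ the spectrum of $G$. (1) Let $G$ be a finite $p$-group, and assume that for some $k \ge 2$ there is an element of order $p$ in $Z_k(G)\setminus Z_{k-1}(G)$. Then the spectrum of $G$ contains the set $\{1, 2, \dots, \min\{k, p-1\}\}$. (2a) For any integers $1 \le k \le p-1$ and $c \ge k$ there is a finite $p$-group of nilpotence class $c$ whose spectrum is $\{1, \dots, k\}$. (2b) For any $n \ge 1$ and any integers $p \le c_1 < c_2 < \dots < c_n \le c$ there is a finite $p$-group of nilpotence class $c$ whose spectrum is $\{1, \dots, p-1, c_1, c_2, \dots, c_n\}$. -/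

import Mathlib

/-- The `i`-th layer `Z_i(G) ∖ Z_{i-1}(G)` of the upper central series of `G`
(meant for `1 ≤ i ≤ c`, where `c` is the nilpotence class of `G`). -/
def upperCentralLayer (G : Type*) [Group G] (i : ℕ) : Set G :=
  (Subgroup.upperCentralSeries G i : Set G) \ (Subgroup.upperCentralSeries G (i - 1) : Set G)

/-- The spectrum of a finite `p`-group `G` of nilpotence class `c`: the set of those
`1 ≤ i ≤ c` for which the `i`-th layer of the upper central series contains an element
of order `p`. -/
def layerSpectrum (p : ℕ) (G : Type*) [Group G] : Set ℕ :=
  {i | 1 ≤ i ∧ i ≤ Group.nilpotencyClass G ∧ ∃ x ∈ upperCentralLayer G i, orderOf x = p}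

open scoped commutatorElement

/-- A descending filtration of a group by subgroups which is compatible with commutators. -/
structure GroupFiltration {G : Type*} [Group G] (F : ℕ → Subgroup G) : Prop where
  antitone : Antitone F
  commutator_mem : ∀ {i j : ℕ} {a b : G}, a ∈ F i → b ∈ F j → ⁅a, b⁆ ∈ F (i + j)

namespace PolySeq

variable {G : Type*} [Group G]

/-- The shift of a sequence, as an endomorphism of the group of sequences. -/
def shift : (ℕ → G) →* (ℕ → G) where
  toFun f n := f (n + 1)
  map_one' := rfl
  map_mul' _ _ := rfl

/-- The (left) difference operator on sequences in a group. -/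
def diff (f : ℕ → G) : ℕ → G := f⁻¹ * shift f

/-- `f` is a polynomial sequence, of weight at least `k`, for the filtration `F`: its `i`-th
differences take values in `F (k + i)`. -/
def IsPoly (F : ℕ → Subgroup G) (k : ℕ) (f : ℕ → G) : Prop :=
  ∀ i n, (diff^[i] f) n ∈ F (k + i)

variable {F : ℕ → Subgroup G} {f g u w : ℕ → G} {i j k l m N : ℕ}

theorem isPoly_iff : IsPoly F k f ↔ (∀ n, f n ∈ F k) ∧ IsPoly F (k + 1) (diff f) := by
  constructor
  · intro h
    refine ⟨h 0, fun i n => ?_⟩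
    have := h (i + 1) n
    rw [Function.iterate_succ_apply] at this
    convert this using 2
    ring
  · rintro ⟨h0, h1⟩ i n
    cases i with
    | zero => exact h0 n
    | succ i =>
      rw [Function.iterate_succ_apply]
      have := h1 i n
      convert this using 2
      ring

theorem IsPoly.mem (h : IsPoly F k f) (n : ℕ) : f n ∈ F k := (isPoly_iff.1 h).1 n

theorem IsPoly.diff (h : IsPoly F k f) : IsPoly F (k + 1) (diff f) := (isPoly_iff.1 h).2

theorem IsPoly.mono (hF : GroupFiltration F) (h : IsPoly F k f) (hl : l ≤ k) : IsPoly F l f :=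
  fun i n => hF.antitone (by omega) (h i n)

theorem diff_one : diff (1 : ℕ → G) = 1 := by simp [diff]

theorem isPoly_one : IsPoly F k (1 : ℕ → G) := by
  intro i n
  rw [Function.iterate_fixed diff_one]
  exact one_mem _

theorem IsPoly.eq_one (hF : GroupFiltration F) (hN : F N = ⊥) (h : IsPoly F k f) (hk : N ≤ k) :
    f = 1 := by
  funext n
  have := hF.antitone hk (h.mem n)
  rwa [hN, Subgroup.mem_bot] at this

theorem diff_mul (f g : ℕ → G) : diff (f * g) = g⁻¹ * diff f * g * diff g := by
  simp only [diff, map_mul]; group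

theorem diff_inv (f : ℕ → G) : diff f⁻¹ = f * (diff f)⁻¹ * f⁻¹ := by
  simp only [diff, map_inv]; group

theorem diff_commutator (f g : ℕ → G) : diff ⁅f, g⁆ =
    ⁅f, g⁆⁻¹ * (f * (⁅diff f, g⁆ * (g * ⁅diff f, diff g⁆ * g⁻¹)) * f⁻¹) * ⁅f, g⁆ *
      (g * ⁅f, diff g⁆ * g⁻¹) := by
  simp only [diff, commutatorElement_def, map_mul, map_inv]; group

theorem diff_conj (f w : ℕ → G) : diff (f * w * f⁻¹) =
    f * (⁅w⁻¹, diff f⁆ * (⁅diff f, diff w⁆ * diff w)) * f⁻¹ := by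
  simp only [diff, map_mul, map_inv, commutatorElement_def]; group

theorem diff_conj_inv (f w : ℕ → G) : diff (f⁻¹ * w * f) =
    f⁻¹ * (⁅w⁻¹, (f * diff f * f⁻¹)⁻¹⁆ *
      (⁅(f * diff f * f⁻¹)⁻¹, diff w⁆ * diff w)) * f := by
  simp only [diff, map_mul, map_inv, commutatorElement_def]; group

/-- The closure properties of polynomial sequences of weight exactly `k`. -/
structure Closed (F : ℕ → Subgroup G) (k : ℕ) : Prop where
  mul : ∀ {f g : ℕ → G}, IsPoly F k f → IsPoly F k g → IsPoly F k (f * g)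
  inv : ∀ {f : ℕ → G}, IsPoly F k f → IsPoly F k f⁻¹
  comm : ∀ {i j : ℕ} {f g : ℕ → G}, 1 ≤ i → 1 ≤ j → i + j = k →
    IsPoly F i f → IsPoly F j g → IsPoly F k ⁅f, g⁆

theorem Closed.conj (hF : GroupFiltration F) (hc : ∀ l, k < l → Closed F l)
    (hi : 1 ≤ i) (hl : k < l) (hf : IsPoly F i f) (hw : IsPoly F l w) :
    IsPoly F l (f * w * f⁻¹) := by
  have : f * w * f⁻¹ = ⁅f, w⁆ * w := by simp [commutatorElement_def]
  rw [this]
  exact (hc l hl).mul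
    (((hc (i + l) (by omega)).comm hi (by omega) rfl hf hw).mono hF (by omega)) hw

theorem Closed.conj_inv (hF : GroupFiltration F) (hN : F N = ⊥) (hc : ∀ l, k < l → Closed F l)
    (hi : 1 ≤ i) (hf : IsPoly F i f) (m : ℕ) : ∀ {l : ℕ} {w : ℕ → G}, k < l → N ≤ l + m →
    IsPoly F l w → IsPoly F l (f⁻¹ * w * f) := by
  induction m with
  | zero =>
    intro l w hl hN' hw
    have : w = 1 := hw.eq_one hF hN (by omega)
    simpa [this] using isPoly_one
  | succ m ih =>
    intro l w hl hN' hw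
    have e : f⁻¹ * w * f = w * (f⁻¹ * ⁅f, w⁻¹⁆ * f) := by
      simp only [commutatorElement_def]; group
    rw [e]
    refine (hc l hl).mul hw (IsPoly.mono hF (k := i + l) ?_ (by omega))
    exact ih (by omega) (by omega)
      ((hc _ (by omega)).comm hi (by omega) rfl hf ((hc l hl).inv hw))

theorem closed_of_pos (hF : GroupFiltration F) (hN : F N = ⊥) (m : ℕ) :
    ∀ k, 1 ≤ k → N ≤ k + m → Closed F k := by
  induction m with
  | zero =>
    intro k hk hkN
    have key : ∀ {f}, IsPoly F k f → f = 1 := fun h => h.eq_one hF hN (by omega)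
    refine ⟨fun hf hg => ?_, fun hf => ?_, fun {i j f g} hi hj hij hf hg => ?_⟩
    · rw [key hf, key hg, mul_one]; exact isPoly_one
    · rw [key hf, inv_one]; exact isPoly_one
    · have : ⁅f, g⁆ = 1 := by
        funext n
        have := hF.antitone (show N ≤ i + j by omega) (hF.commutator_mem (hf.mem n) (hg.mem n))
        rwa [hN, Subgroup.mem_bot] at this
      rw [this]; exact isPoly_one
  | succ m ih =>
    intro k hk hkN
    have hc : ∀ l, k < l → Closed F l := fun l hl => ih l (by omega) (by omega)
    have hc1 := hc (k + 1) (by omega)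
    have cj : ∀ {i f w}, 1 ≤ i → IsPoly F i f → IsPoly F (k + 1) w →
        IsPoly F (k + 1) (f * w * f⁻¹) := fun hi hf hw =>
      Closed.conj hF hc hi (by omega) hf hw
    have cj' : ∀ {i f w}, 1 ≤ i → IsPoly F i f → IsPoly F (k + 1) w →
        IsPoly F (k + 1) (f⁻¹ * w * f) := fun hi hf hw =>
      Closed.conj_inv hF hN hc hi hf N (by omega) (by omega) hw
    refine ⟨fun {f g} hf hg => ?_, fun {f} hf => ?_, fun {i j f g} hi hj hij hf hg => ?_⟩
    · refine isPoly_iff.2 ⟨fun n => mul_mem (hf.mem n) (hg.mem n), ?_⟩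
      rw [diff_mul]
      exact hc1.mul (cj' hk hg hf.diff) hg.diff
    · refine isPoly_iff.2 ⟨fun n => inv_mem (hf.mem n), ?_⟩
      rw [diff_inv]
      exact cj hk hf (hc1.inv hf.diff)
    · refine isPoly_iff.2 ⟨fun n => hij ▸ hF.commutator_mem (hf.mem n) (hg.mem n), ?_⟩
      rw [diff_commutator]
      have h1 : IsPoly F (k + 1) ⁅diff f, g⁆ :=
        hc1.comm (by omega) hj (by omega) hf.diff hg
      have h2 : IsPoly F (k + 1) ⁅diff f, diff g⁆ :=
        ((hc (k + 2) (by omega)).comm (i := i + 1) (j := j + 1) (by omega) (by omega) (by omega)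
          hf.diff hg.diff).mono hF (by omega)
      have h3 : IsPoly F (k + 1) ⁅f, diff g⁆ :=
        hc1.comm hi (by omega) (by omega) hf hg.diff
      refine hc1.mul ?_ (cj hj hg h3)
      have h4 := cj hi hf (hc1.mul h1 (cj hj hg h2))
      have h5 := cj hj hg (cj hi hf (cj' hj hg (cj' hi hf h4)))
      convert h5 using 1
      simp only [commutatorElement_def]; group

theorem IsPoly.conj_zero (hF : GroupFiltration F) (hN : F N = ⊥)
    (hf : IsPoly F 0 f) (m : ℕ) : ∀ {l : ℕ} {w : ℕ → G}, 1 ≤ l → N ≤ l + m →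
    IsPoly F l w → IsPoly F l (f * w * f⁻¹) := by
  have hc : ∀ k, 1 ≤ k → Closed F k := fun k hk => closed_of_pos hF hN N k hk (by omega)
  induction m with
  | zero =>
    intro l w hl hN' hw
    have : w = 1 := hw.eq_one hF hN (by omega)
    simpa [this] using isPoly_one
  | succ m ih =>
    intro l w hl hN' hw
    refine isPoly_iff.2 ⟨fun n => ?_, ?_⟩
    · have := mul_mem (hF.antitone (by omega) (hF.commutator_mem (hf.mem n) (hw.mem n)) :
        ⁅f n, w n⁆ ∈ F l) (hw.mem n)
      simpa [commutatorElement_def] using this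
    · rw [diff_conj]
      have hc1 := hc (l + 1) (by omega)
      refine ih (by omega) (by omega) (hc1.mul ?_ (hc1.mul ?_ hw.diff))
      · exact hc1.comm hl le_rfl rfl ((hc l hl).inv hw) hf.diff
      · exact ((hc (1 + (l + 1)) (by omega)).comm le_rfl (by omega) rfl
          hf.diff hw.diff).mono hF (by omega)

theorem IsPoly.conj_inv_zero (hF : GroupFiltration F) (hN : F N = ⊥)
    (hf : IsPoly F 0 f) (m : ℕ) : ∀ {l : ℕ} {w : ℕ → G}, 1 ≤ l → N ≤ l + m →
    IsPoly F l w → IsPoly F l (f⁻¹ * w * f) := by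
  have hc : ∀ k, 1 ≤ k → Closed F k := fun k hk => closed_of_pos hF hN N k hk (by omega)
  induction m with
  | zero =>
    intro l w hl hN' hw
    have : w = 1 := hw.eq_one hF hN (by omega)
    simpa [this] using isPoly_one
  | succ m ih =>
    intro l w hl hN' hw
    refine isPoly_iff.2 ⟨fun n => ?_, ?_⟩
    · have := mul_mem (hF.antitone (by omega)
        (hF.commutator_mem (inv_mem (hf.mem n)) (hw.mem n)) : ⁅(f n)⁻¹, w n⁆ ∈ F l) (hw.mem n)
      simpa [commutatorElement_def] using this
    · rw [diff_conj_inv]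
      have hc1 := hc (l + 1) (by omega)
      have hu : IsPoly F 1 (f * PolySeq.diff f * f⁻¹)⁻¹ :=
        (hc 1 le_rfl).inv (IsPoly.conj_zero hF hN hf N le_rfl (by omega) hf.diff)
      refine ih (by omega) (by omega) (hc1.mul ?_ (hc1.mul ?_ hw.diff))
      · exact hc1.comm hl le_rfl rfl ((hc l hl).inv hw) hu
      · exact ((hc (1 + (l + 1)) (by omega)).comm le_rfl (by omega) rfl
          hu hw.diff).mono hF (by omega)

/-- **Lazard–Leibman**: products of polynomial sequences are polynomial. -/
theorem IsPoly.mul (hF : GroupFiltration F) (hN : F N = ⊥)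
    (hf : IsPoly F 0 f) (hg : IsPoly F 0 g) : IsPoly F 0 (f * g) := by
  refine isPoly_iff.2 ⟨fun n => mul_mem (hf.mem n) (hg.mem n), ?_⟩
  rw [diff_mul]
  exact (closed_of_pos hF hN N 1 le_rfl (by omega)).mul
    (IsPoly.conj_inv_zero hF hN hg N le_rfl (by omega) hf.diff) hg.diff

theorem diff_pow_choose (a : G) (i : ℕ) :
    diff (fun n => a ^ n.choose (i + 1)) = fun n => a ^ n.choose i := by
  funext n
  simp only [diff, shift, Pi.mul_apply, Pi.inv_apply, MonoidHom.coe_mk, OneHom.coe_mk]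
  rw [Nat.choose_succ_succ', add_comm (n.choose i), pow_add, inv_mul_cancel_left]

theorem isPoly_pow_choose (hF : GroupFiltration F) {a : G} (i : ℕ) :
    ∀ {k : ℕ}, a ∈ F (k + i) → IsPoly F k (fun n => a ^ n.choose i) := by
  induction i with
  | zero =>
    intro k ha
    refine isPoly_iff.2 ⟨fun n => by simpa using ha, ?_⟩
    have : diff (fun n : ℕ => a ^ n.choose 0) = 1 := by
      funext n; simp [diff, shift]
    rw [this]
    exact isPoly_one
  | succ i ih =>
    intro k ha
    refine isPoly_iff.2 ⟨fun n => pow_mem (hF.antitone (by omega) ha) _, ?_⟩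
    rw [diff_pow_choose]
    exact ih (by convert ha using 2; ring)

/-- The value of a sequence at the first place where it may be nontrivial is an iterated
difference at `0`. -/
theorem iterate_diff_zero (i : ℕ) : ∀ {f : ℕ → G}, (∀ n < i, f n = 1) →
    (diff^[i] f) 0 = f i := by
  have key : ∀ (i m : ℕ) (f : ℕ → G), (∀ n < i + m, f n = 1) →
      (∀ n < m, (diff^[i] f) n = 1) ∧ (diff^[i] f) m = f (i + m) := by
    intro i
    induction i with
    | zero => intro m f hf; exact ⟨fun n hn => hf n (by omega), by simp⟩
    | succ i ih =>
      intro m f hf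
      obtain ⟨h1, h2⟩ := ih (m + 1) f (fun n hn => hf n (by omega))
      simp only [Function.iterate_succ_apply']
      refine ⟨fun n hn => ?_, ?_⟩
      · simp [diff, shift, h1 n (by omega), h1 (n + 1) (by omega)]
      · simp only [diff, shift, Pi.mul_apply, Pi.inv_apply, MonoidHom.coe_mk, OneHom.coe_mk,
          h1 m (by omega), h2, inv_one, one_mul]
        congr 1
        ring
  intro f hf
  exact (key i 0 f (by simpa using hf)).2

theorem IsPoly.apply_prime {p : ℕ} (hp : p.Prime) (hF : GroupFiltration F)
    (hFp : F p = ⊥) (hexp : ∀ a ∈ F 2, a ^ p = 1) (m : ℕ) : ∀ {i : ℕ} {f : ℕ → G}, 2 ≤ i →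
    p = i + m → IsPoly F 0 f → (∀ n < i, f n = 1) → f p = 1 := by
  induction m with
  | zero =>
    intro i f hi hpi hf h1
    have := hf i 0
    rw [add_zero] at hpi
    rwa [iterate_diff_zero i h1, Nat.zero_add, ← hpi, hFp, Subgroup.mem_bot] at this
  | succ m ih =>
    intro i f hi hpi hf h1
    have ha : f i ∈ F i := by
      have := hf i 0
      rwa [iterate_diff_zero i h1, Nat.zero_add] at this
    have hq : IsPoly F 0 (fun n => (f i)⁻¹ ^ n.choose i) :=
      isPoly_pow_choose hF i (by simpa using ha)
    have := ih (i := i + 1) (by omega) (by omega) (hf.mul hF hFp hq) (fun n hn => by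
      rcases Nat.lt_succ_iff_lt_or_eq.1 hn with h | h
      · simp [h1 n h, Nat.choose_eq_zero_of_lt h]
      · simp [h])
    obtain ⟨q, hq⟩ : p ∣ p.choose i := hp.dvd_choose_self (by omega) (by omega)
    simpa [hq, pow_mul, hexp _ (hF.antitone hi ha)] using this

/-- **Hall**: if all commutators have order dividing `p` and the class is less than `p`, then
`p`-th powers are multiplicative. -/
theorem mul_pow_prime {p : ℕ} (hp : p.Prime) (hF : GroupFiltration F)
    (h1 : F 1 = ⊤) (hFp : F p = ⊥) (hexp : ∀ a ∈ F 2, a ^ p = 1) (x y : G) :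
    (x * y) ^ p = x ^ p * y ^ p := by
  have pw : ∀ a : G, IsPoly F 0 (fun n => a ^ n) := fun a => by
    simpa using isPoly_pow_choose hF (F := F) (a := a) 1 (k := 0) (by simp [h1])
  have h := ((pw y⁻¹).mul hF hFp (pw x⁻¹)).mul hF hFp (pw (x * y))
  have := IsPoly.apply_prime hp hF hFp hexp (p - 2) le_rfl
    (by have := hp.two_le; omega) h (fun n hn => by interval_cases n <;> simp)
  simp only [Pi.mul_apply, inv_pow] at this
  rw [← mul_inv_rev, inv_mul_eq_one] at this
  exact this.symm

end PolySeq

namespace Subgroup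

theorem commutator_commutator_le_of_rotate {G : Type*} [Group G] {H₁ H₂ H₃ N : Subgroup G}
    [N.Normal] (h1 : ⁅⁅H₂, H₃⁆, H₁⁆ ≤ N) (h2 : ⁅⁅H₃, H₁⁆, H₂⁆ ≤ N) : ⁅⁅H₁, H₂⁆, H₃⁆ ≤ N := by
  have key : ∀ K : Subgroup G, K ≤ N ↔ K.map (QuotientGroup.mk' N) = ⊥ := fun K => by
    rw [Subgroup.map_eq_bot_iff, QuotientGroup.ker_mk']
  rw [key] at h1 h2 ⊢
  simp only [Subgroup.map_commutator] at h1 h2 ⊢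
  exact commutator_commutator_eq_bot_of_rotate h1 h2

theorem commutator_lowerCentralSeries_le {G : Type*} [Group G] (j : ℕ) : ∀ i : ℕ,
    ⁅(⊤ : Subgroup G).lowerCentralSeries i, (⊤ : Subgroup G).lowerCentralSeries j⁆ ≤
      (⊤ : Subgroup G).lowerCentralSeries (i + j + 1) := by
  induction j with
  | zero => intro i; exact le_of_eq rfl
  | succ j ih =>
    intro i
    rw [commutator_comm, lowerCentralSeries_succ _ j]
    refine commutator_commutator_le_of_rotate ?_ ?_
    · rw [commutator_comm ⊤, ← lowerCentralSeries_succ]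
      exact (ih (i + 1)).trans (lowerCentralSeries_antitone _ (by omega))
    · exact commutator_mono (ih i) le_rfl

theorem groupFiltration_lowerCentralSeries (G : Type*) [Group G] :
    GroupFiltration (fun i => (⊤ : Subgroup G).lowerCentralSeries (i - 1)) where
  antitone _ _ h := lowerCentralSeries_antitone _ (by omega)
  commutator_mem := by
    intro i j a b ha hb
    have h := commutator_lowerCentralSeries_le (j - 1) (i - 1) (commutator_mem_commutator ha hb)
    exact lowerCentralSeries_antitone _ (by omega) h

variable {G : Type*} [Group G]

theorem mem_comap_centralizer_iff (N : Subgroup G) [N.Normal] {a z : G} :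
    z ∈ (centralizer {(QuotientGroup.mk' N a)}).comap (QuotientGroup.mk' N) ↔ ⁅a, z⁆ ∈ N := by
  rw [mem_comap, mem_centralizer_singleton_iff, ← QuotientGroup.eq_one_iff (N := N) ⁅a, z⁆,
    ← QuotientGroup.coe_mk', map_commutatorElement, commutatorElement_eq_one_iff_mul_comm, eq_comm]

theorem commutator_mem_swap (N : Subgroup G) {a b : G} (h : ⁅a, b⁆ ∈ N) : ⁅b, a⁆ ∈ N := by
  rw [← commutatorElement_inv]; exact inv_mem h

/-- The normal closure of a single element has smaller class than the group. -/
theorem commutator_normalClosure_singleton_le (x : G) :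
    ⁅normalClosure {x}, normalClosure {x}⁆ ≤ (⊤ : Subgroup G).lowerCentralSeries 2 := by
  set L := (⊤ : Subgroup G).lowerCentralSeries 2
  have key : ∀ a : G, ⁅a, x⁆ ∈ L → ∀ z ∈ normalClosure {x}, ⁅a, z⁆ ∈ L := by
    intro a ha z hz
    rw [← mem_comap_centralizer_iff]
    revert z
    rw [← SetLike.le_def, normalClosure, closure_le]
    intro z hz
    rw [Group.mem_conjugatesOfSet_iff] at hz
    obtain ⟨w, hw, hz⟩ := hz
    rw [Set.mem_singleton_iff.1 hw] at hz
    obtain ⟨g, rfl⟩ := isConj_iff.1 hz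
    have e : g * x * g⁻¹ = ⁅g, x⁆ * x := by simp [commutatorElement_def]
    rw [e, SetLike.mem_coe]
    refine mul_mem ((mem_comap_centralizer_iff L).2 ?_) ((mem_comap_centralizer_iff L).2 ha)
    exact commutator_mem_swap _ (commutator_mem_commutator
      (commutator_mem_commutator (mem_top g) (mem_top x)) (mem_top a))
  rw [commutator_le]
  intro a ha b hb
  exact key a (commutator_mem_swap _ (key x (by simp) a ha)) b hb

theorem lowerCentralSeries_normalClosure_singleton_le (x : G) (i : ℕ) :
    (normalClosure {x}).lowerCentralSeries (i + 1) ≤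
      (⊤ : Subgroup G).lowerCentralSeries (i + 2) := by
  induction i with
  | zero => exact commutator_normalClosure_singleton_le x
  | succ i ih => exact commutator_mono ih le_top

theorem commutator_le_normalClosure_of_closure_pair {x y : G} (h : closure {x, y} = ⊤) :
    ⁅(⊤ : Subgroup G), (⊤ : Subgroup G)⁆ ≤ normalClosure {x} := by
  set N := normalClosure {x}
  have key : ∀ g : G, QuotientGroup.mk' N g ∈ zpowers (QuotientGroup.mk' N y) := by
    intro g
    have hg : g ∈ closure {x, y} := h ▸ mem_top g
    rw [← mem_comap]
    revert g
    intro g hg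
    refine (closure_le _).2 ?_ hg
    rintro z (rfl | rfl)
    · have : QuotientGroup.mk' N z = 1 :=
        (QuotientGroup.eq_one_iff z).2 (subset_normalClosure rfl)
      rw [SetLike.mem_coe, mem_comap, this]
      exact one_mem _
    · exact mem_zpowers _
  rw [commutator_le]
  intro a _ b _
  rw [← QuotientGroup.ker_mk' N, MonoidHom.mem_ker, map_commutatorElement,
    commutatorElement_eq_one_iff_mul_comm]
  obtain ⟨i, hi⟩ := key a
  obtain ⟨j, hj⟩ := key b
  rw [← hi, ← hj]
  exact (Commute.refl _).zpow_zpow _ _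

/-- **Hall**: in a group of class less than `p`, elements of order dividing `p` are closed under
products. -/
theorem mul_pow_prime_eq_one_of_lowerCentralSeries {p : ℕ} (hp : p.Prime) (m : ℕ) (hm : m < p) :
    ∀ {G : Type*} [Group G], (⊤ : Subgroup G).lowerCentralSeries m = ⊥ →
      ∀ {x y : G}, x ^ p = 1 → y ^ p = 1 → (x * y) ^ p = 1 := by
  induction m with
  | zero =>
    intro G _ h x y _ _
    have : x * y ∈ (⊥ : Subgroup G) := h ▸ mem_top _
    rw [mem_bot.1 this, one_pow]
  | succ m ih =>
    rcases m with _ | m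
    · intro G _ h x y hx hy
      have : ⁅x, y⁆ ∈ (⊥ : Subgroup G) := h ▸ commutator_mem_commutator (mem_top x) (mem_top y)
      rw [(commutatorElement_eq_one_iff_commute.1 (mem_bot.1 this)).mul_pow, hx, hy, one_mul]
    have gen : ∀ {G : Type _} [Group G], (⊤ : Subgroup G).lowerCentralSeries (m + 2) = ⊥ →
        ∀ {x y : G}, closure {x, y} = ⊤ → x ^ p = 1 → y ^ p = 1 → (x * y) ^ p = 1 := by
      intro G _ hG x y hxy hx hy
      let N := normalClosure {x}
      have hN : (⊤ : Subgroup N).lowerCentralSeries (m + 1) = ⊥ := by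
        have h1 := lowerCentralSeries_normalClosure_singleton_le x m
        rw [hG, le_bot_iff, ← top_subtype_lowerCentralSeries] at h1
        exact (Subgroup.map_eq_bot_iff_of_injective _ N.subtype_injective).1 h1
      let E : Subgroup G :=
        { carrier := {z | z ∈ N ∧ z ^ p = 1}
          one_mem' := ⟨one_mem _, one_pow _⟩
          mul_mem' := by
            rintro a b ⟨ha, ha'⟩ ⟨hb, hb'⟩
            refine ⟨mul_mem ha hb, ?_⟩
            have := ih (by omega) hN (x := ⟨a, ha⟩) (y := ⟨b, hb⟩) (Subtype.ext ha')
              (Subtype.ext hb')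
            exact congrArg Subtype.val this
          inv_mem' := by
            rintro a ⟨ha, ha'⟩
            exact ⟨inv_mem ha, by rw [inv_pow, ha', inv_one]⟩ }
      have hE : E.Normal := ⟨by
        rintro a ⟨ha, ha'⟩ g
        exact ⟨normalClosure_normal.conj_mem a ha g, by rw [conj_pow, ha']; simp⟩⟩
      have hNE : N ≤ E := normalClosure_le_normal
        (Set.singleton_subset_iff.2 ⟨subset_normalClosure rfl, hx⟩)
      have := PolySeq.mul_pow_prime hp (groupFiltration_lowerCentralSeries G) rfl
        (le_bot_iff.1 (hG ▸ lowerCentralSeries_antitone _ (by omega)))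
        (fun a ha => (hNE (commutator_le_normalClosure_of_closure_pair hxy ha)).2) x y
      rw [this, hx, hy, one_mul]
    intro G _ hG x y hx hy
    let H := closure {x, y}
    have hxH : x ∈ H := subset_closure (by simp)
    have hyH : y ∈ H := subset_closure (by simp)
    have hH : (⊤ : Subgroup H).lowerCentralSeries (m + 2) = ⊥ := by
      have h1 := lowerCentralSeries_mono (m + 2) (le_top : H ≤ ⊤)
      simp only [hG] at h1
      rw [le_bot_iff, ← top_subtype_lowerCentralSeries] at h1
      exact (Subgroup.map_eq_bot_iff_of_injective _ H.subtype_injective).1 h1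
    have := gen hH (x := ⟨x, hxH⟩) (y := ⟨y, hyH⟩) (by
      rw [← closure_closure_coe_preimage (k := ({x, y} : Set G))]
      congr 1
      ext z
      simp [Subtype.ext_iff]) (Subtype.ext hx) (Subtype.ext hy)
    exact congrArg Subtype.val this

theorem mul_pow_prime_eq_one_of_upperCentralSeries {p : ℕ} (hp : p.Prime) {G : Type*} [Group G]
    (h : upperCentralSeries G (p - 1) = ⊤) {x y : G} (hx : x ^ p = 1) (hy : y ^ p = 1) :
    (x * y) ^ p = 1 :=
  mul_pow_prime_eq_one_of_lowerCentralSeries hp (p - 1) (Nat.sub_lt hp.pos one_pos)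
    (lowerCentralSeries_eq_bot_iff_upperCentralSeries_eq_top.2 h) hx hy

theorem mem_upperCentralSeries_subgroup {G : Type*} [Group G] (H : Subgroup G) (i : ℕ) :
    ∀ z : H, (z : G) ∈ upperCentralSeries G i → z ∈ upperCentralSeries H i := by
  induction i with
  | zero => intro z hz; exact mem_bot.2 (Subtype.ext (mem_bot (G := G).1 hz))
  | succ i ih =>
    intro z hz
    rw [mem_upperCentralSeries_succ_iff] at hz ⊢
    exact fun y => ih _ (hz y)

/-- **Hall**, without a bound on the class of the group: only the class of the subgroup generated by
`x` and `y` matters. -/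
theorem mul_pow_prime_eq_one_of_commutator_mem {p : ℕ} (hp : p.Prime) {G : Type*} [Group G]
    {x y : G} (hxy : ⁅x, y⁆ ∈ upperCentralSeries G (p - 2)) (hx : x ^ p = 1) (hy : y ^ p = 1) :
    (x * y) ^ p = 1 := by
  let H := closure {x, y}
  set Z := upperCentralSeries G (p - 2)
  have key : ∀ a : G, ⁅a, x⁆ ∈ Z → ⁅a, y⁆ ∈ Z → ∀ b ∈ H, ⁅a, b⁆ ∈ Z := by
    intro a h1 h2 b hb
    rw [← mem_comap_centralizer_iff]
    refine (closure_le _).2 ?_ hb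
    rintro z (rfl | rfl)
    · exact (mem_comap_centralizer_iff Z).2 h1
    · exact (mem_comap_centralizer_iff Z).2 h2
  have key2 : ∀ a ∈ H, ∀ b ∈ H, ⁅a, b⁆ ∈ Z := fun a ha => key a
    (commutator_mem_swap _ (key x (by simp) hxy a ha))
    (commutator_mem_swap _ (key y (commutator_mem_swap _ hxy) (by simp) a ha))
  have hH : upperCentralSeries H (p - 1) = ⊤ := by
    rw [eq_top_iff]
    intro z _
    rw [show p - 1 = p - 2 + 1 by have := hp.two_le; omega, mem_upperCentralSeries_succ_iff]
    intro y
    exact mem_upperCentralSeries_subgroup H _ _ (key2 z z.2 y y.2)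
  have := mul_pow_prime_eq_one_of_upperCentralSeries hp hH
    (x := ⟨x, subset_closure (by simp)⟩) (y := ⟨y, subset_closure (by simp)⟩)
    (Subtype.ext hx) (Subtype.ext hy)
  exact congrArg Subtype.val this

end Subgroup

namespace Subgroup

/-- Elements of `Z_{i+2} ∖ Z_{i+1}` of order `p`, with `i + 2 < p`, have commutators of order `p` in
the next lower layer. -/
theorem exists_orderOf_mem_upperCentralLayer_of_succ {p : ℕ} (hp : p.Prime) {G : Type*} [Group G]
    {i : ℕ} (hi : i + 2 < p) {x : G} (hx : x ∈ upperCentralLayer G (i + 2)) (ho : orderOf x = p) :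
    ∃ y ∈ upperCentralLayer G (i + 1), orderOf y = p := by
  obtain ⟨h1, h2⟩ := hx
  simp only [SetLike.mem_coe, show i + 2 - 1 = i + 1 by omega] at h1 h2
  rw [mem_upperCentralSeries_succ_iff] at h1 h2
  push Not at h2
  obtain ⟨g, hg⟩ := h2
  refine ⟨⁅x, g⁆, ⟨h1 g, by simpa using hg⟩, ?_⟩
  have : Fact p.Prime := ⟨hp⟩
  refine orderOf_eq_prime ?_ (fun h => hg (h ▸ one_mem _))
  have hxp : x ^ p = 1 := ho ▸ pow_orderOf_eq_one x
  have e : ⁅x, g⁆ = x * (g * x⁻¹ * g⁻¹) := by simp [commutatorElement_def, mul_assoc]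
  rw [e]
  refine mul_pow_prime_eq_one_of_commutator_mem hp ?_ hxp ?_
  · exact upperCentralSeries_mono G (by omega)
      (mem_upperCentralSeries_succ_iff.1 (mem_upperCentralSeries_succ_iff.2 h1) _)
  · rw [conj_pow, inv_pow, hxp]; simp

theorem exists_mem_upperCentralLayer {G : Type*} [Group G] {n : ℕ} {x : G} (hx : x ≠ 1)
    (h : x ∈ Subgroup.upperCentralSeries G n) : ∃ i, 1 ≤ i ∧ i ≤ n ∧ x ∈ upperCentralLayer G i := by
  classical
  have hex : ∃ i, x ∈ Subgroup.upperCentralSeries G i := ⟨n, h⟩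
  have h0 : Nat.find hex ≠ 0 := fun h0 => hx (by
    have := Nat.find_spec hex
    rw [h0] at this
    exact Subgroup.mem_bot.1 this)
  exact ⟨Nat.find hex, by omega, Nat.find_min' hex h, Nat.find_spec hex,
    fun h' => Nat.find_min hex (by omega) h'⟩

/-- If some layer above the `p-1`-st one contains an element of order `p`, so does the
`p-1`-st. -/
theorem exists_orderOf_mem_upperCentralLayer_pred {p : ℕ} (hp : p.Prime) {G : Type*} [Group G]
    [Group.IsNilpotent G] {k : ℕ} (hk : p ≤ k)
    (hx : ∃ x ∈ upperCentralLayer G k, orderOf x = p) :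
    ∃ y ∈ upperCentralLayer G (p - 1), orderOf y = p := by
  have h2 := hp.two_le
  have : Fact p.Prime := ⟨hp⟩
  induction k using Nat.strong_induction_on with
  | _ k ih =>
    by_contra hcon
    obtain ⟨x, ⟨hxk, hxk'⟩, ho⟩ := hx
    have hxp : x ^ p = 1 := ho ▸ pow_orderOf_eq_one x
    have small : ∀ u : G, u ∈ upperCentralSeries G (k - 1) → u ^ p = 1 →
        u ∈ upperCentralSeries G (p - 2) := by
      intro u hu hup
      by_cases hu1 : u = 1
      · exact hu1 ▸ one_mem _
      obtain ⟨j, hj1, hjk, hj⟩ := exists_mem_upperCentralLayer hu1 hu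
      have huo := orderOf_eq_prime hup hu1
      rcases lt_trichotomy j (p - 1) with h | rfl | h
      · exact upperCentralSeries_mono G (by omega) hj.1
      · exact absurd ⟨u, hj, huo⟩ hcon
      · exact absurd (ih j (by omega) (by omega) ⟨u, hj, huo⟩) hcon
    have key : ∀ i, ∀ g ∈ upperCentralSeries G i, ⁅x, g⁆ ∈ upperCentralSeries G (p - 2) := by
      intro i
      induction i with
      | zero => intro g hg; rw [mem_bot.1 hg]; simp
      | succ i ihi =>
        intro g hg
        have hgx : ⁅x, g⁆ ∈ upperCentralSeries G i :=
          commutator_mem_swap _ (mem_upperCentralSeries_succ_iff.1 hg x)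
        have hxu := ihi _ hgx
        have hxk1 : ⁅x, g⁆ ∈ upperCentralSeries G (k - 1) :=
          mem_upperCentralSeries_succ_iff.1 (by rwa [show k - 1 + 1 = k by omega]) g
        refine small _ hxk1 ?_
        have e : ⁅x, g⁆ = x * (g * x⁻¹ * g⁻¹) := by simp [commutatorElement_def, mul_assoc]
        have e' : g * x⁻¹ * g⁻¹ = x⁻¹ * ⁅x, g⁆ := by simp [commutatorElement_def, mul_assoc]
        rw [e]
        refine mul_pow_prime_eq_one_of_commutator_mem hp ?_ hxp ?_
        · rw [e', ← mem_comap_centralizer_iff]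
          exact mul_mem (inv_mem ((mem_comap_centralizer_iff _).2 (by simp)))
            ((mem_comap_centralizer_iff _).2 hxu)
        · rw [conj_pow, inv_pow, hxp]; simp
    refine hxk' (upperCentralSeries_mono G (show p - 1 ≤ k - 1 by omega) ?_)
    rw [show p - 1 = p - 2 + 1 by omega, mem_upperCentralSeries_succ_iff]
    intro g
    exact key (Group.nilpotencyClass G) g (by rw [upperCentralSeries_nilpotencyClass]; trivial)

/-- The spectrum contains every index up to `p - 1` below an element of it. -/
theorem Icc_subset_layerSpectrum {p : ℕ} (hp : p.Prime) {G : Type*} [Group G] [Finite G]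
    (hG : IsPGroup p G) {k : ℕ} (hk : 2 ≤ k) (hx : ∃ x ∈ upperCentralLayer G k, orderOf x = p) :
    Set.Icc 1 (min k (p - 1)) ⊆ layerSpectrum p G := by
  have : Fact p.Prime := ⟨hp⟩
  have hnil : Group.IsNilpotent G := hG.isNilpotent
  have top : ∃ x ∈ upperCentralLayer G (min k (p - 1)), orderOf x = p := by
    rcases le_total k (p - 1) with h | h
    · rwa [min_eq_left h]
    · rw [min_eq_right h]
      rcases h.eq_or_lt with h | h
      · rwa [h]
      · exact exists_orderOf_mem_upperCentralLayer_pred hp (by omega) hx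
  have down : ∀ m i, i + 1 + m = min k (p - 1) →
      ∃ x ∈ upperCentralLayer G (i + 1), orderOf x = p := by
    intro m
    induction m with
    | zero => intro i hi; rw [add_zero] at hi; rwa [hi]
    | succ m ih =>
      intro i hi
      obtain ⟨x, hx, ho⟩ := ih (i + 1) (by omega)
      exact exists_orderOf_mem_upperCentralLayer_of_succ hp (by omega) hx ho
  rintro i ⟨h1, h2⟩
  obtain ⟨x, hx, ho⟩ := down (min k (p - 1) - i) (i - 1) (by omega)
  rw [Nat.sub_add_cancel h1] at hx
  refine ⟨h1, ?_, x, hx, ho⟩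
  by_contra hlt
  refine hx.2 ?_
  have : Subgroup.upperCentralSeries G (i - 1) = ⊤ :=
    Subgroup.upperCentralSeries_eq_top_iff_nilpotencyClass_le.2 (by omega)
  rw [this]
  trivial

end Subgroup

/-- The semidirect product `S ⋊ C` of the additive group of a commutative ring `S` by a group `C`
acting on `S` through multiplication by units. -/
@[ext]
structure ScalarExtension {S C : Type} [CommRing S] [CommGroup C] (χ : C →* Sˣ) where
  left : S
  right : C

namespace ScalarExtension

variable {S C : Type} [CommRing S] [CommGroup C] {χ : C →* Sˣ}

instance : Mul (ScalarExtension χ) := ⟨fun x y => ⟨x.left + χ x.right * y.left, x.right * y.right⟩⟩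

instance : One (ScalarExtension χ) := ⟨⟨0, 1⟩⟩

instance : Inv (ScalarExtension χ) := ⟨fun x => ⟨-((χ x.right)⁻¹ : Sˣ) * x.left, x.right⁻¹⟩⟩

@[simp] theorem mul_left (x y : ScalarExtension χ) :
    (x * y).left = x.left + χ x.right * y.left := rfl
@[simp] theorem mul_right (x y : ScalarExtension χ) : (x * y).right = x.right * y.right := rfl
@[simp] theorem one_left : (1 : ScalarExtension χ).left = 0 := rfl
@[simp] theorem one_right : (1 : ScalarExtension χ).right = 1 := rfl
@[simp] theorem inv_right (x : ScalarExtension χ) : x⁻¹.right = x.right⁻¹ := rfl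
@[simp] theorem inv_left (x : ScalarExtension χ) :
    x⁻¹.left = -((χ x.right)⁻¹ : Sˣ) * x.left := rfl

instance : Group (ScalarExtension χ) :=
  Group.ofLeftAxioms
    (fun x y z => by ext <;> simp [mul_assoc, mul_add, add_assoc])
    (fun x => by ext <;> simp)
    (fun x => by ext <;> simp)

/-- The bijection of `S ⋊ C` with `S × C`. -/
def equivProd (χ : C →* Sˣ) : ScalarExtension χ ≃ S × C where
  toFun x := (x.left, x.right)
  invFun x := ⟨x.1, x.2⟩

instance [Finite S] [Finite C] : Finite (ScalarExtension χ) := Finite.of_equiv _ (equivProd χ).symm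

theorem isPGroup {p : ℕ} [Finite S] [Finite C]
    (hS : ∃ n, Nat.card S = p ^ n) (hC : ∃ n, Nat.card C = p ^ n) :
    IsPGroup p (ScalarExtension χ) := by
  obtain ⟨a, ha⟩ := hS
  obtain ⟨b, hb⟩ := hC
  refine IsPGroup.of_card (n := a + b) ?_
  rw [Nat.card_congr (equivProd χ), Nat.card_prod, ha, hb, pow_add]

theorem pow_right (x : ScalarExtension χ) (n : ℕ) : (x ^ n).right = x.right ^ n := by
  induction n with
  | zero => simp
  | succ n ih => rw [pow_succ, mul_right, ih, pow_succ]

theorem pow_left {x : ScalarExtension χ} (hx : χ x.right * x.left = x.left) (n : ℕ) :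
    (x ^ n).left = n * x.left := by
  induction n with
  | zero => simp
  | succ n ih =>
    rw [pow_succ', mul_left, ih, mul_left_comm, hx]
    push_cast
    ring

theorem commutator_eq (x y : ScalarExtension χ) :
    ⁅x, y⁆ = ⟨((χ x.right : S) - 1) * y.left - ((χ y.right : S) - 1) * x.left, 1⟩ := by
  rw [commutatorElement_def, mul_assoc, ← mul_inv_rev, mul_inv_eq_iff_eq_mul]
  ext
  · simp; ring
  · simp [mul_comm]

variable {t : S}

theorem mem_upperCentralSeries (ht : ∀ c, t ∣ (χ c : S) - 1) (i : ℕ) :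
    ∀ a : S, t ^ i * a = 0 →
      (⟨a, 1⟩ : ScalarExtension χ) ∈ Subgroup.upperCentralSeries (ScalarExtension χ) i := by
  induction i with
  | zero =>
    intro a ha
    rw [pow_zero, one_mul] at ha
    exact Subgroup.mem_bot.2 (by rw [ha]; rfl)
  | succ i ih =>
    intro a ha
    rw [Subgroup.mem_upperCentralSeries_succ_iff]
    intro y
    rw [commutator_eq]
    obtain ⟨r, hr⟩ := ht y.right
    refine ih _ ?_
    simp only [hr, map_one, Units.val_one, sub_self, zero_mul, zero_sub]
    linear_combination (-r) * ha

theorem pow_mul_eq_zero {s : C} (hs : (χ s : S) = 1 + t) (i : ℕ) :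
    ∀ a : S, (⟨a, 1⟩ : ScalarExtension χ) ∈ Subgroup.upperCentralSeries (ScalarExtension χ) i →
      t ^ i * a = 0 := by
  induction i with
  | zero =>
    intro a ha
    rw [pow_zero, one_mul]
    exact congrArg ScalarExtension.left (Subgroup.mem_bot.1 ha)
  | succ i ih =>
    intro a ha
    rw [Subgroup.mem_upperCentralSeries_succ_iff] at ha
    have := ha ⟨0, s⟩
    rw [commutator_eq] at this
    have := ih _ this
    simp only [hs, map_one, Units.val_one, sub_self, zero_mul, zero_sub] at this
    linear_combination -this

theorem upperCentralSeries_eq_top (ht : ∀ c, t ∣ (χ c : S) - 1) {d : ℕ} (hd : 1 ≤ d)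
    (htd : t ^ d = 0) : Subgroup.upperCentralSeries (ScalarExtension χ) d = ⊤ := by
  obtain ⟨d, rfl⟩ := Nat.exists_eq_add_of_le' hd
  rw [eq_top_iff]
  intro x _
  rw [Subgroup.mem_upperCentralSeries_succ_iff]
  intro y
  rw [commutator_eq]
  refine mem_upperCentralSeries ht _ _ ?_
  obtain ⟨r, hr⟩ := ht x.right
  obtain ⟨r', hr'⟩ := ht y.right
  rw [hr, hr']
  linear_combination (r * y.left - r' * x.left) * htd

theorem nilpotencyClass_eq (ht : ∀ c, t ∣ (χ c : S) - 1) {s : C} (hs : (χ s : S) = 1 + t) {d : ℕ}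
    (hd : 1 ≤ d) (htd : t ^ d = 0) (htd' : t ^ (d - 1) ≠ 0) :
    Group.nilpotencyClass (ScalarExtension χ) = d := by
  have htop := upperCentralSeries_eq_top ht hd htd
  have : Group.IsNilpotent (ScalarExtension χ) := ⟨d, htop⟩
  refine le_antisymm (Subgroup.upperCentralSeries_eq_top_iff_nilpotencyClass_le.1 htop) ?_
  by_contra hlt
  have h1 : Subgroup.upperCentralSeries (ScalarExtension χ) (d - 1) = ⊤ :=
    Subgroup.upperCentralSeries_eq_top_iff_nilpotencyClass_le.2 (by omega)
  have := pow_mul_eq_zero hs (d - 1) 1 (h1 ▸ Subgroup.mem_top _)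
  exact htd' (by simpa using this)

end ScalarExtension

/-- For a unit `u` of order dividing `q` there is a cyclic group of order `q` whose generator acts as
`u`. -/
theorem exists_cyclic_hom {S : Type} [CommRing S] (u : Sˣ) (t : S) (hu : (u : S) = 1 + t) (q : ℕ)
    (hq : q ≠ 0) (huq : u ^ q = 1) :
    ∃ (χ : Multiplicative (ZMod q) →* Sˣ), χ (Multiplicative.ofAdd 1) = u ∧
      ∀ c, t ∣ (χ c : S) - 1 := by
  have : NeZero q := ⟨hq⟩
  have gen : ∀ c : Multiplicative (ZMod q), ∃ k : ℕ, (Multiplicative.ofAdd (1 : ZMod q)) ^ k = c :=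
    fun c => ⟨c.toAdd.val, by
      rw [← ofAdd_nsmul]
      simp⟩
  have hg : ∀ c : Multiplicative (ZMod q),
      c ∈ Subgroup.zpowers (Multiplicative.ofAdd (1 : ZMod q)) := fun c => by
    obtain ⟨k, rfl⟩ := gen c
    exact Subgroup.npow_mem_zpowers _ _
  have ho : orderOf (Multiplicative.ofAdd (1 : ZMod q)) = q := by
    rw [orderOf_ofAdd_eq_addOrderOf, ZMod.addOrderOf_one]
  have h1 := monoidHomOfForallMemZpowers_apply_gen hg (ho.symm ▸ orderOf_dvd_of_pow_eq_one huq)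
  refine ⟨_, h1, fun c => ?_⟩
  obtain ⟨k, rfl⟩ := gen c
  rw [map_pow, h1, Units.val_pow_eq_pow_val, hu]
  simpa using sub_dvd_pow_sub_pow (1 + t) 1 k

/-- There is a finite `p`-group of class `c` with spectrum `s`. -/
def LayerSpectrumRealizable (p c : ℕ) (s : Set ℕ) : Prop :=
  ∃ (G : Type) (_ : Group G) (_ : Finite G), IsPGroup p G ∧
    Group.nilpotencyClass G = c ∧ layerSpectrum p G = s

open ScalarExtension in
/-- Split extensions in which the acting generator has order `p`. -/
theorem realizable_of_order_prime {p : ℕ} (hp : p.Prime) {S : Type} [CommRing S] [Finite S]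
    (hS : ∃ n, Nat.card S = p ^ n) (u : Sˣ) (t : S) (hu : (u : S) = 1 + t) (hup : u ^ p = 1)
    {d : ℕ} (hd : 1 ≤ d) (htd : t ^ d = 0) (htd' : t ^ (d - 1) ≠ 0)
    (hann : ∀ a : S, p * a = 0 → t ^ (p - 1) * a = 0) :
    LayerSpectrumRealizable p d (Set.Icc 1 (min d (p - 1)) ∪ {d}) := by
  have : Fact p.Prime := ⟨hp⟩
  have : NeZero p := ⟨hp.ne_zero⟩
  have h2 := hp.two_le
  obtain ⟨χ, hχ, ht⟩ := exists_cyclic_hom u t hu p hp.ne_zero hup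
  set s : Multiplicative (ZMod p) := Multiplicative.ofAdd 1
  have hs : (χ s : S) = 1 + t := by rw [hχ, hu]
  have hcard : Nat.card (Multiplicative (ZMod p)) = p := by
    rw [Nat.card_congr Multiplicative.toAdd, Nat.card_zmod]
  have hP : IsPGroup p (ScalarExtension χ) := isPGroup hS ⟨1, by rw [hcard, pow_one]⟩
  have hcl := nilpotencyClass_eq ht hs hd htd htd'
  have hs1 : s ≠ 1 := by
    intro h
    exact one_ne_zero (Multiplicative.ofAdd.injective h : (1 : ZMod p) = 0)
  have hout : ∀ x : ScalarExtension χ, x.right ≠ 1 →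
      x ∉ Subgroup.upperCentralSeries (ScalarExtension χ) (d - 1) := by
    intro x hx hxd
    have hgen : s ∈ Submonoid.powers x.right := by
      rw [mem_powers_iff_mem_zpowers, zpowers_eq_top_of_prime_card hcard hx]
      trivial
    obtain ⟨m, hm⟩ := hgen
    have hxm := pow_mem hxd m
    have hr : (x ^ m).right = s := by rw [pow_right]; exact hm
    obtain ⟨d, rfl⟩ := Nat.exists_eq_add_of_le' hd
    rw [Nat.add_sub_cancel] at hxm htd'
    cases d with
    | zero =>
      rw [Subgroup.mem_bot.1 hxm] at hr
      exact hs1 hr.symm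
    | succ d =>
      have := Subgroup.mem_upperCentralSeries_succ_iff.1 hxm ⟨1, 1⟩
      rw [commutator_eq, hr, hs] at this
      have := pow_mul_eq_zero hs _ _ this
      refine htd' ?_
      rw [pow_succ]
      simpa using this
  have hdmem : ∃ x ∈ upperCentralLayer (ScalarExtension χ) d, orderOf x = p := by
    refine ⟨⟨0, s⟩, ⟨?_, hout _ hs1⟩, orderOf_eq_prime ?_ ?_⟩
    · rw [upperCentralSeries_eq_top ht hd htd]; trivial
    · ext
      · rw [pow_left (by simp)]; simp
      · rw [pow_right, one_right]
        exact orderOf_dvd_iff_pow_eq_one.1 (hcard ▸ orderOf_dvd_natCard s)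
    · intro h
      exact hs1 (congrArg ScalarExtension.right h)
  refine ⟨ScalarExtension χ, inferInstance, inferInstance, hP, hcl, ?_⟩
  apply Set.Subset.antisymm
  · rintro i ⟨hi1, hic, x, ⟨hxi, hxi'⟩, ho⟩
    rw [hcl] at hic
    by_cases hx : x.right = 1
    · left
      have hxp : x ^ p = 1 := orderOf_dvd_iff_pow_eq_one.1 ho.dvd
      have hpx : (p : S) * x.left = 0 := by
        rw [← pow_left (by rw [hx]; simp), hxp, one_left]
      have hmem := mem_upperCentralSeries ht _ _ (hann _ hpx)
      rw [← hx] at hmem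
      refine ⟨hi1, le_min hic ?_⟩
      by_contra hlt
      exact hxi' (Subgroup.upperCentralSeries_mono _ (by omega) hmem)
    · right
      by_contra hne
      have : i ≠ d := hne
      exact hout x hx (Subgroup.upperCentralSeries_mono _ (by omega) hxi)
  · have hd' : d ∈ layerSpectrum p (ScalarExtension χ) := ⟨hd, hcl.ge, hdmem⟩
    rintro i (hi | rfl)
    · rcases hd.eq_or_lt with rfl | h
      · obtain ⟨h1, h2⟩ := hi
        rwa [show i = 1 by omega]
      · exact Subgroup.Icc_subset_layerSpectrum hp hP h hdmem hi
    · exact hd'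

open ScalarExtension in
/-- Every class is realized by a group all of whose elements of order `p` are central. -/
theorem realizable_singleton_one {p : ℕ} (hp : p.Prime) {c : ℕ} (hc : 1 ≤ c) :
    LayerSpectrumRealizable p c {1} := by
  have : Fact p.Prime := ⟨hp⟩
  have h2 := hp.two_le
  have hq : p ^ c ≠ 0 := pow_ne_zero _ hp.ne_zero
  have : NeZero (p ^ c) := ⟨hq⟩
  have key : (1 + (p : ZMod (p ^ c))) ^ p ^ (c - 1) = 1 := by
    have h := dvd_sub_pow_of_dvd_sub (R := ℤ) (p := p) (a := 1 + p) (b := 1) (by simp) (c - 1)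
    rw [Nat.sub_add_cancel hc, one_pow] at h
    have h' := (ZMod.intCast_zmod_eq_zero_iff_dvd _ (p ^ c)).2 (by exact_mod_cast h)
    push_cast at h'
    exact sub_eq_zero.1 h'
  let t : ZMod (p ^ c) := p
  obtain ⟨u, hu⟩ : ∃ u : (ZMod (p ^ c))ˣ, (u : ZMod (p ^ c)) = 1 + t :=
    ⟨Units.ofPowEqOne _ _ key (pow_ne_zero _ hp.ne_zero), rfl⟩
  have hup : u ^ p ^ (c - 1) = 1 := by
    ext; rw [Units.val_pow_eq_pow_val, hu, key, Units.val_one]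
  have hcs : p ^ c = p ^ (c - 1) * p := by rw [← pow_succ, Nat.sub_add_cancel hc]
  obtain ⟨χ, hχ, ht⟩ := exists_cyclic_hom u t hu (p ^ c) hq 
    (orderOf_dvd_iff_pow_eq_one.1 ((orderOf_dvd_of_pow_eq_one hup).trans ⟨p, hcs⟩))
  have hs : (χ (Multiplicative.ofAdd 1) : ZMod (p ^ c)) = 1 + t := by rw [hχ, hu]
  have htd : t ^ c = 0 := by
    have := ZMod.natCast_self (p ^ c)
    rwa [Nat.cast_pow] at this
  have htd' : t ^ (c - 1) ≠ 0 := by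
    intro h
    have h' : ((p ^ (c - 1) : ℕ) : ZMod (p ^ c)) = 0 := by rw [Nat.cast_pow]; exact h
    rw [ZMod.natCast_eq_zero_iff, Nat.pow_dvd_pow_iff_le_right h2] at h'
    omega
  have hcl := nilpotencyClass_eq ht hs hc htd htd'
  have hP : IsPGroup p (ScalarExtension χ) := isPGroup ⟨c, Nat.card_zmod _⟩
    ⟨c, by rw [Nat.card_congr Multiplicative.toAdd, Nat.card_zmod]⟩
  refine ⟨ScalarExtension χ, inferInstance, inferInstance, hP, hcl, ?_⟩
  apply Set.Subset.antisymm
  · rintro i ⟨hi1, hic, x, ⟨hxi, hxi'⟩, ho⟩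
    have hxp : x ^ p = 1 := orderOf_dvd_iff_pow_eq_one.1 ho.dvd
    have hχx : χ x.right = 1 := by
      have hr : x.right ^ p = 1 := by rw [← pow_right, hxp, one_right]
      obtain ⟨z, hz⟩ : ∃ z : ZMod (p ^ c), Multiplicative.ofAdd z = x.right := ⟨_, rfl⟩
      have hz' : x.right = Multiplicative.ofAdd (1 : ZMod (p ^ c)) ^ z.val := by
        rw [← hz, ← ofAdd_nsmul]; simp
      rw [hz', ← pow_mul, ← orderOf_dvd_iff_pow_eq_one, orderOf_ofAdd_eq_addOrderOf,
        ZMod.addOrderOf_one] at hr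
      obtain ⟨m, hm⟩ := Nat.dvd_of_mul_dvd_mul_right hp.pos (hcs.symm.dvd.trans hr)
      rw [hz', map_pow, hχ, hm, pow_mul, hup, one_pow]
    have hta : t * x.left = 0 := by
      have := pow_left (x := x) (by rw [hχx]; simp) p
      rw [hxp, one_left] at this
      exact this.symm
    have hx1 : x ∈ Subgroup.upperCentralSeries (ScalarExtension χ) 1 := by
      rw [← zero_add 1, Subgroup.mem_upperCentralSeries_succ_iff]
      intro y
      rw [commutator_eq]
      obtain ⟨r, hr⟩ := ht y.right
      refine Subgroup.mem_bot.2 (ScalarExtension.ext ?_ rfl)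
      simp only [hχx, hr, Units.val_one, sub_self, zero_mul, zero_sub, one_left]
      linear_combination (-r) * hta
    by_contra hne
    have : i ≠ 1 := hne
    exact hxi' (Subgroup.upperCentralSeries_mono _ (by omega) hx1)
  · rintro _ rfl
    refine ⟨le_rfl, hcl.symm ▸ hc, ⟨t ^ (c - 1), 1⟩, ⟨?_, ?_⟩, orderOf_eq_prime ?_ ?_⟩
    · refine mem_upperCentralSeries ht 1 _ ?_
      rw [pow_one, ← pow_succ', Nat.sub_add_cancel hc, htd]
    · intro h
      exact htd' (congrArg ScalarExtension.left (Subgroup.mem_bot.1 h))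
    · ext1
      · rw [pow_left (by simp), one_left]
        change t * _ = 0
        rw [← pow_succ', Nat.sub_add_cancel hc, htd]
      · rw [pow_right]; simp
    · intro h
      exact htd' (congrArg ScalarExtension.left h)

open NumberField in
theorem realizable_of_isCyclotomicExtension {p : ℕ} (hp : p.Prime) (K : Type) [Field K]
    [NumberField K] [IsCyclotomicExtension {p} ℚ K] {d : ℕ} (hd : 1 ≤ d) :
    LayerSpectrumRealizable p d (Set.Icc 1 (min d (p - 1)) ∪ {d}) := by
  have : Fact p.Prime := ⟨hp⟩
  have : NeZero p := ⟨hp.ne_zero⟩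
  have hζ := IsCyclotomicExtension.zeta_spec p ℚ K
  have hζ' := hζ.toInteger_isPrimitiveRoot
  set ζ : 𝓞 K := hζ.toInteger
  have hprime : Prime (ζ - 1) := hζ.zeta_sub_one_prime'
  have hζp : ζ ^ p = 1 := hζ'.pow_eq_one
  set l : 𝓞 K := ζ - 1 with hl
  have hlζ : ζ = l + 1 := by rw [hl]; ring
  obtain ⟨r, hr⟩ : ∃ r, l ^ (p - 1) = p * r := by
    obtain ⟨r, hr⟩ := exists_add_pow_prime_eq hp l 1
    refine ⟨-r, mul_left_cancel₀ hprime.ne_zero ?_⟩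
    rw [← pow_succ', Nat.sub_add_cancel hp.one_le]
    rw [← hlζ, hζp] at hr
    linear_combination -hr
  have hlp : l ∣ (p : 𝓞 K) := by
    have h0 := hζ'.geom_sum_eq_zero hp.one_lt
    have h1 : (p : 𝓞 K) = -∑ i ∈ Finset.range p, (ζ ^ i - 1) := by
      rw [Finset.sum_sub_distrib, h0]; simp
    rw [h1, dvd_neg]
    exact Finset.dvd_sum fun i _ => by simpa using sub_dvd_pow_sub_pow ζ 1 i
  let I : Ideal (𝓞 K) := Ideal.span {l ^ d}
  have hI : I ≠ ⊥ := by
    rw [Ne, Ideal.span_singleton_eq_bot]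
    exact pow_ne_zero _ hprime.ne_zero
  have hfin : Finite (𝓞 K ⧸ I) := I.finiteQuotientOfFreeOfNeBot hI
  let π := Ideal.Quotient.mk I
  have hπ : ∀ x, π x = 0 ↔ l ^ d ∣ x := fun x => by
    rw [Ideal.Quotient.eq_zero_iff_mem, Ideal.mem_span_singleton]
  have hcard : ∃ n, Nat.card (𝓞 K ⧸ I) = p ^ n := by
    have h : IsPGroup p (Multiplicative (𝓞 K ⧸ I)) := fun g => ⟨d, by
      have h0 : ((p ^ d : ℕ) : 𝓞 K ⧸ I) = 0 := by
        have := (hπ ((p : 𝓞 K) ^ d)).2 (pow_dvd_pow_of_dvd hlp d)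
        simpa using this
      apply Multiplicative.toAdd.injective
      rw [toAdd_pow, nsmul_eq_mul, h0, zero_mul, toAdd_one]⟩
    obtain ⟨n, hn⟩ := IsPGroup.iff_card.1 h
    exact ⟨n, by rw [← hn, Nat.card_congr Multiplicative.toAdd]⟩
  obtain ⟨u, hu⟩ : ∃ u : (𝓞 K ⧸ I)ˣ, (u : 𝓞 K ⧸ I) = π ζ :=
    ⟨Units.ofPowEqOne (π ζ) p (by rw [← map_pow, hζp, map_one]) hp.ne_zero, rfl⟩
  refine realizable_of_order_prime hp hcard u (π l) ?_ ?_ hd ?_ ?_ ?_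
  · rw [hu, hlζ, map_add, map_one, add_comm]
  · ext; rw [Units.val_pow_eq_pow_val, hu, ← map_pow, hζp, map_one, Units.val_one]
  · rw [← map_pow, hπ]
  · rw [← map_pow, Ne, hπ, pow_dvd_pow_iff hprime.ne_zero hprime.not_isUnit]
    omega
  · intro a ha
    rw [← map_pow, hr, map_mul, map_natCast]
    linear_combination (π r) * ha

theorem realizable_cyclotomic {p : ℕ} (hp : p.Prime) {d : ℕ} (hd : 1 ≤ d) :
    LayerSpectrumRealizable p d (Set.Icc 1 (min d (p - 1)) ∪ {d}) := by
  have : NeZero p := ⟨hp.ne_zero⟩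
  have : NeZero (p : ℚ) := ⟨Nat.cast_ne_zero.2 hp.ne_zero⟩
  have : IsCyclotomicExtension {p} ℚ (CyclotomicField p ℚ) :=
    CyclotomicField.isCyclotomicExtension p ℚ
  have : NumberField (CyclotomicField p ℚ) := IsCyclotomicExtension.numberField {p} ℚ _
  exact realizable_of_isCyclotomicExtension hp (CyclotomicField p ℚ) hd

namespace Subgroup

theorem mem_upperCentralSeries_prod {G H : Type*} [Group G] [Group H] (n : ℕ) : ∀ x : G × H,
    x ∈ upperCentralSeries (G × H) n ↔
      x.1 ∈ upperCentralSeries G n ∧ x.2 ∈ upperCentralSeries H n := by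
  induction n with
  | zero =>
    intro x
    simp only [upperCentralSeries_zero, mem_bot]
    exact Prod.ext_iff
  | succ n ih =>
    intro x
    simp only [mem_upperCentralSeries_succ_iff, ih]
    exact ⟨fun h => ⟨fun y => (h (y, 1)).1, fun y => (h (1, y)).2⟩,
      fun h y => ⟨h.1 y.1, h.2 y.2⟩⟩

end Subgroup

theorem le_nilpotencyClass_of_mem_upperCentralLayer {G : Type*} [Group G] [Group.IsNilpotent G] {i : ℕ}
    {x : G} (hx : x ∈ upperCentralLayer G i) : i ≤ Group.nilpotencyClass G := by
  by_contra hlt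
  refine hx.2 ?_
  rw [Subgroup.upperCentralSeries_eq_top_iff_nilpotencyClass_le.2 (by omega)]
  trivial

theorem layerSpectrum_prod {p : ℕ} (hp : p.Prime) {G H : Type*} [Group G] [Group H]
    [Group.IsNilpotent G] [Group.IsNilpotent H] :
    layerSpectrum p (G × H) = layerSpectrum p G ∪ layerSpectrum p H := by
  have : Fact p.Prime := ⟨hp⟩
  ext i
  constructor
  · rintro ⟨h1, -, x, ⟨hx, hx'⟩, ho⟩
    have hxp : x ^ p = 1 := orderOf_dvd_iff_pow_eq_one.1 ho.dvd
    obtain ⟨hp1, hp2⟩ := Prod.ext_iff.1 hxp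
    simp only [SetLike.mem_coe, Subgroup.mem_upperCentralSeries_prod, not_and_or] at hx hx'
    rcases hx' with h | h
    · have hl : x.1 ∈ upperCentralLayer G i := ⟨hx.1, h⟩
      exact Or.inl ⟨h1, le_nilpotencyClass_of_mem_upperCentralLayer hl, x.1, hl,
        orderOf_eq_prime hp1 (fun e => h (e ▸ one_mem _))⟩
    · have hl : x.2 ∈ upperCentralLayer H i := ⟨hx.2, h⟩
      exact Or.inr ⟨h1, le_nilpotencyClass_of_mem_upperCentralLayer hl, x.2, hl,
        orderOf_eq_prime hp2 (fun e => h (e ▸ one_mem _))⟩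
  · rintro (⟨h1, h2, x, ⟨hx, hx'⟩, ho⟩ | ⟨h1, h2, x, ⟨hx, hx'⟩, ho⟩)
    · have hl : ((x, 1) : G × H) ∈ upperCentralLayer (G × H) i :=
        ⟨(Subgroup.mem_upperCentralSeries_prod _ _).2 ⟨hx, one_mem _⟩,
          fun h => hx' ((Subgroup.mem_upperCentralSeries_prod _ _).1 h).1⟩
      exact ⟨h1, le_nilpotencyClass_of_mem_upperCentralLayer hl, _, hl, by
        rw [Prod.orderOf_mk, ho, orderOf_one, Nat.lcm_one_right]⟩
    · have hl : ((1, x) : G × H) ∈ upperCentralLayer (G × H) i :=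
        ⟨(Subgroup.mem_upperCentralSeries_prod _ _).2 ⟨one_mem _, hx⟩,
          fun h => hx' ((Subgroup.mem_upperCentralSeries_prod _ _).1 h).2⟩
      exact ⟨h1, le_nilpotencyClass_of_mem_upperCentralLayer hl, _, hl, by
        rw [Prod.orderOf_mk, ho, orderOf_one, Nat.lcm_one_left]⟩

theorem LayerSpectrumRealizable.prod {p : ℕ} (hp : p.Prime) {c c' : ℕ} {s s' : Set ℕ}
    (h : LayerSpectrumRealizable p c s) (h' : LayerSpectrumRealizable p c' s') :
    LayerSpectrumRealizable p (max c c') (s ∪ s') := by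
  have : Fact p.Prime := ⟨hp⟩
  obtain ⟨G, _, _, hG, rfl, rfl⟩ := h
  obtain ⟨H, _, _, hH, rfl, rfl⟩ := h'
  have := hG.isNilpotent
  have := hH.isNilpotent
  refine ⟨G × H, inferInstance, inferInstance, ?_, Group.nilpotencyClass_prod,
    layerSpectrum_prod hp⟩
  obtain ⟨a, ha⟩ := IsPGroup.iff_card.1 hG
  obtain ⟨b, hb⟩ := IsPGroup.iff_card.1 hH
  exact IsPGroup.of_card (n := a + b) (by rw [Nat.card_prod, ha, hb, pow_add])

theorem realizable_biUnion {p : ℕ} (hp : p.Prime) {c : ℕ} (hc : 1 ≤ c) (D : Finset ℕ)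
    (hD : ∀ d ∈ D, 1 ≤ d ∧ d ≤ c) :
    LayerSpectrumRealizable p c ({1} ∪ ⋃ d ∈ D, (Set.Icc 1 (min d (p - 1)) ∪ {d})) := by
  induction D using Finset.induction_on with
  | empty => simpa using realizable_singleton_one hp hc
  | insert d D _ ih =>
    obtain ⟨h1, h2⟩ := hD d (Finset.mem_insert_self d D)
    have := (realizable_cyclotomic hp h1).prod hp
      (ih fun e he => hD e (Finset.mem_insert_of_mem he))
    rw [max_eq_right h2] at this
    convert this using 1
    rw [Finset.set_biUnion_insert, Set.union_left_comm]

theorem theorem1p3 (p : ℕ) (hp : p.Prime) :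
    (∀ (G : Type*) [Group G] [Finite G], IsPGroup p G →
      ∀ k : ℕ, 2 ≤ k → (∃ x ∈ upperCentralLayer G k, orderOf x = p) →
        Set.Icc 1 (min k (p - 1)) ⊆ layerSpectrum p G) ∧
    (∀ k c : ℕ, 1 ≤ k → k ≤ p - 1 → k ≤ c →
      ∃ (G : Type) (_ : Group G) (_ : Finite G), IsPGroup p G ∧
        Group.nilpotencyClass G = c ∧ layerSpectrum p G = Set.Icc 1 k) ∧
    (∀ (n : ℕ) (d : Fin n → ℕ) (c : ℕ), 1 ≤ n → StrictMono d →
      (∀ i, p ≤ d i) → (∀ i, d i ≤ c) →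
      ∃ (G : Type) (_ : Group G) (_ : Finite G), IsPGroup p G ∧
        Group.nilpotencyClass G = c ∧
        layerSpectrum p G = Set.Icc 1 (p - 1) ∪ Set.range d) := by
  have h2 := hp.two_le
  refine ⟨fun G _ _ hG k hk hx => Subgroup.Icc_subset_layerSpectrum hp hG hk hx,
    fun k c hk hkp hkc => ?_, fun n d c hn _ hpd hdc => ?_⟩
  · have := realizable_biUnion hp (hk.trans hkc) {k} (by simpa using ⟨hk, hkc⟩)
    change LayerSpectrumRealizable p c (Set.Icc 1 k)
    convert this using 1
    ext i
    simp only [Finset.mem_singleton, Set.iUnion_iUnion_eq_left, min_eq_left hkp, Set.mem_union,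
      Set.mem_singleton_iff, Set.mem_Icc]
    omega
  · have h0 : Fin n := ⟨0, hn⟩
    have := realizable_biUnion hp (c := c) (by have := hpd h0; have := hdc h0; omega)
      (Finset.univ.image d) (by
        intro e he
        obtain ⟨i, -, rfl⟩ := Finset.mem_image.1 he
        exact ⟨by have := hpd i; omega, hdc i⟩)
    change LayerSpectrumRealizable p c (Set.Icc 1 (p - 1) ∪ Set.range d)
    convert this using 1
    ext i
    have hmin : ∀ j, min (d j) (p - 1) = p - 1 := fun j => min_eq_right (by have := hpd j; omega)
    simp only [Set.mem_union, Set.mem_Icc, Set.mem_range, Set.mem_singleton_iff,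
      Set.mem_iUnion, Finset.mem_image, Finset.mem_univ, true_and, exists_prop, exists_exists_eq_and,
      hmin]
    constructor
    · rintro (h | ⟨j, rfl⟩)
      · exact Or.inr ⟨h0, Or.inl h⟩
      · exact Or.inr ⟨j, Or.inr rfl⟩
    · rintro (rfl | ⟨j, h | rfl⟩)
      · exact Or.inl ⟨le_rfl, by omega⟩
      · exact Or.inl h
      · exact Or.inr ⟨j, rfl⟩
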